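/- Let $m\le p\le n$ and let $A_m\in\mathbb{R}^{n\times n}$, $B_m\in\mathbb{R}^{n\times m}$, $C_m\in\mathbb{R}^{p\times n}$ be such that $A_m$ is Hurwitz (all its eigenvalues have negative real part) and $(A_m,B_m,C_m)$ is a minimal realization (that is, $(A_m,B_m)$ is controllable and $(A_m,C_m)$ is observable) of the stable transfer matrix $M(s)=C_m(s\mathbb{I}_n-A_m)^{-1}B_m$. Suppose that $M(s)$ has full normal column rank $m$ (its rank over the field $\mathbb{R}(s)$ is $m$) and that $C_mB_m$ is rank deficient, i.e. $\operatorname{rank}(C_mB_m)<m$. Then there exist an integer $n_z\ge 0$ and matrices $A_z\in\mathbb{R}^{n_z\times n_z}$, $B_z\in\mathbb{R}^{n_z\times m}$, $C_z\in\mathbb{R}^{m\times n_z}$, $D_z\in\mathbb{R}^{m\times m}$, $\bar B\in\mathbb{R}^{n\times m}$, $T_z\in\mathbb{R}^{n\times n_z}$ such that $A_z$ is Hurwitz, $$\det\begin{bmatrix}-s\mathbb{I}_{n_z}+A_z & B_z\\ C_z & D_z\end{bmatrix}\neq 0\qquad\text{for all } s\in\mathbb{C},$$ the stable transfer matrix $Z(s)=C_z(s\mathbb{I}_{n_z}-A_z)^{-1}B_z+D_z$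 is invertible over $\mathbb{R}(s)$, $$\bar M(s):=C_m(s\mathbb{I}_n-A_m)^{-1}\bar B=M(s)Z^{-1}(s),$$ $$A_mT_z=T_zA_z+\bar BC_z,\qquad C_mA_mT_z=C_m\bar BC_z,\qquad B_m=T_zB_z+\bar BD_z,\qquad C_mB_m=C_m\bar BD_z,$$ and $T_z$ has full column rank $n_z$. Moreover, for these matrices: - $(A_m,\bar B)$ is controllable, and $C_m\bar B$ has full rank $m$; - if $M(s)$ has no unstable zeros, then $\bar M(s)$ has no unstable zeros. Here a zero of a transfer matrix with a minimal realization $(A,B,C)$, $A\in\mathbb{R}^{n\times n}$, is a transmission zero, that is, a number $s\in\mathbb{C}$ with $\operatorname{rank}\begin{bmatrix}-s\mathbb{I}_n+A&B\\C&0\end{bmatrix}<n+\min(m,p)$, and it is unstable if $\operatorname{Re}s\ge 0$; the realizations used are $(A_m,B_m,C_m)$ and $(A_m,\bar B,C_m)$, both of which are minimal. -/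

import Mathlib

namespace LTI

/-- The transfer matrix `C (s I - A)⁻¹ B + D` of the state-space system `(A, B, C, D)`, as a matrix
of real rational functions in the indeterminate `s`.  The determinant of `s I - A` is the
characteristic polynomial of `A`, so the inverse is a true inverse. -/
noncomputable def transferMatrix {n m p : ℕ} (A : Matrix (Fin n) (Fin n) ℝ)
    (B : Matrix (Fin n) (Fin m) ℝ) (C : Matrix (Fin p) (Fin n) ℝ) (D : Matrix (Fin p) (Fin m) ℝ) :
    Matrix (Fin p) (Fin m) (RatFunc ℝ) :=
  C.map (algebraMap ℝ (RatFunc ℝ)) *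
      (Matrix.scalar (Fin n) (RatFunc.X : RatFunc ℝ) - A.map (algebraMap ℝ (RatFunc ℝ)))⁻¹ *
      B.map (algebraMap ℝ (RatFunc ℝ)) +
    D.map (algebraMap ℝ (RatFunc ℝ))

/-- A real square matrix is Hurwitz if all its complex eigenvalues have negative real part. -/
def IsHurwitz {n : ℕ} (A : Matrix (Fin n) (Fin n) ℝ) : Prop :=
  ∀ z ∈ spectrum ℂ (A.map (algebraMap ℝ ℂ)), z.re < 0

/-- `(A, B)` is controllable: the controllability matrix `[B, A B, …, A ^ (n - 1) B]` has rank
`n`. -/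
def IsControllable {n m : ℕ} (A : Matrix (Fin n) (Fin n) ℝ) (B : Matrix (Fin n) (Fin m) ℝ) :
    Prop :=
  (Matrix.of fun (i : Fin n) (q : Fin n × Fin m) => (A ^ (q.1 : ℕ) * B) i q.2).rank = n

/-- `(A, C)` is observable: the observability matrix with block rows `C, C A, …, C A ^ (n - 1)`
has rank `n`. -/
def IsObservable {n p : ℕ} (A : Matrix (Fin n) (Fin n) ℝ) (C : Matrix (Fin p) (Fin n) ℝ) :
    Prop :=
  (Matrix.of fun (q : Fin n × Fin p) (i : Fin n) => (C * A ^ (q.1 : ℕ)) q.2 i).rank = n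

/-- `(A, B, C)` is a minimal realization (of its transfer matrix): it is controllable and
observable. -/
def IsMinimal {n m p : ℕ} (A : Matrix (Fin n) (Fin n) ℝ) (B : Matrix (Fin n) (Fin m) ℝ)
    (C : Matrix (Fin p) (Fin n) ℝ) : Prop :=
  IsControllable A B ∧ IsObservable A C

/-- The system matrix (Rosenbrock pencil) `[-s I + A, B; C, D]` at the complex number `s`. -/
noncomputable def systemMatrix {n m p : ℕ} (A : Matrix (Fin n) (Fin n) ℝ)
    (B : Matrix (Fin n) (Fin m) ℝ) (C : Matrix (Fin p) (Fin n) ℝ) (D : Matrix (Fin p) (Fin m) ℝ)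
    (s : ℂ) : Matrix (Fin n ⊕ Fin p) (Fin n ⊕ Fin m) ℂ :=
  Matrix.fromBlocks (-Matrix.scalar (Fin n) s + A.map (algebraMap ℝ ℂ)) (B.map (algebraMap ℝ ℂ))
    (C.map (algebraMap ℝ ℂ)) (D.map (algebraMap ℝ ℂ))

/-- `s` is a transmission zero of the system `(A, B, C, D)`: the system matrix at `s` has rank
smaller than `n + min m p`.  If the realization is minimal, these are the (transmission) zeros of
its transfer matrix. -/
def IsTransmissionZero {n m p : ℕ} (A : Matrix (Fin n) (Fin n) ℝ)
    (B : Matrix (Fin n) (Fin m) ℝ) (C : Matrix (Fin p) (Fin n) ℝ) (D : Matrix (Fin p) (Fin m) ℝ)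
    (s : ℂ) : Prop :=
  (systemMatrix A B C D s).rank < n + min m p

/-- The system has no unstable zeros: every transmission zero lies in the open left half-plane. -/
def NoUnstableZeros {n m p : ℕ} (A : Matrix (Fin n) (Fin n) ℝ)
    (B : Matrix (Fin n) (Fin m) ℝ) (C : Matrix (Fin p) (Fin n) ℝ) (D : Matrix (Fin p) (Fin m) ℝ) :
    Prop :=
  ∀ s : ℂ, IsTransmissionZero A B C D s → s.re < 0

end LTI

open Matrix

namespace LTI

/-! Zeros at infinity are moved one at a time to a stable point `-a`. If `C * Bb` is rank deficient,
choose `v ≠ 0` with `C * Bb * v = 0` and `w * v = 1`, and put `b = Bb * v`. Since `C b = 0`, `C (s -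
A)⁻¹ (A + a) b = (s + a) C (s - A)⁻¹ b`. So replacing the column `b` in direction `v` by `(A + a) b`
multiplies the plant by `1 - v w + (s + a) v w`. The inverse of this factor, with its stable pole
`-a` and no finite zero, is absorbed into `Z`, and `b` is appended to the columns of `T`.

The invariant `IsCascade` includes `C * T = 0`, which yields both output identities, and injectivity
of `T`. Injectivity survives the step because the plant has full normal column rank
(`IsCascade.extend`). As `T` has `n` rows, at most `n` steps are possible, so some `C * Bb` attains
rank `m`. Controllability (`InputsSpan.update_input`) and absence of zeros other than `-a`
(`PencilInjective.update_input`) persist throughout. -/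

/-- The pencil `[A - s I, B; C, D]` has trivial kernel. -/
def PencilInjective {K ι κ ρ : Type*} [Field K] [Fintype ι] [Fintype κ] (A : Matrix ι ι K)
    (B : Matrix ι κ K) (C : Matrix ρ ι K) (D : Matrix ρ κ K) (s : K) : Prop :=
  ∀ x u, A *ᵥ x + B *ᵥ u = s • x → C *ᵥ x + D *ᵥ u = 0 → x = 0 ∧ u = 0

/-! ### Effect of one first-order factor on pencils and controllability. -/

section Field

variable {K ι κ ρ : Type*} [Field K] [Fintype ι] [Fintype κ]

/-- The pencil of the cascade of `(A, B, C, D)` with the first-order factor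
`(-a, w, v, 1 - v w)` has trivial kernel. -/
theorem PencilInjective.cascade [DecidableEq κ] {A : Matrix ι ι K} {B : Matrix ι κ K}
    {C : Matrix κ ι K} {D : Matrix κ κ K} {s : K} (h : PencilInjective A B C D s) (a : K)
    {v : Matrix κ Unit K} {w : Matrix Unit κ K} (hwv : w * v = 1) :
    PencilInjective (fromBlocks A 0 (w * C) (-a • (1 : Matrix Unit Unit K)))
      (fromRows B (w * D)) (fromCols ((1 - v * w) * C) v) ((1 - v * w) * D) s := by
  intro x u hx hy
  obtain ⟨x₁, x₂, rfl⟩ : ∃ x₁ x₂, x = Sum.elim x₁ x₂ := ⟨x ∘ Sum.inl, x ∘ Sum.inr, by simp⟩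
  rw [fromBlocks_mulVec, fromRows_mulVec, Sum.elim_add_add] at hx
  have h₁ : A *ᵥ x₁ + B *ᵥ u = s • x₁ := by
    ext i; simpa using congrFun hx (Sum.inl i)
  have h₂ : w *ᵥ (C *ᵥ x₁ + D *ᵥ u) - a • x₂ = s • x₂ := by
    ext i
    have := congrFun hx (Sum.inr i)
    simp [mulVec_add, smul_mulVec, neg_mulVec, ← mulVec_mulVec] at this ⊢
    linear_combination this
  set y := C *ᵥ x₁ + D *ᵥ u with hydef
  have h₃ : (1 - v * w) *ᵥ y + v *ᵥ x₂ = 0 := by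
    rw [fromCols_mulVec_sumElim, ← mulVec_mulVec, ← mulVec_mulVec] at hy
    rw [hydef, mulVec_add, ← hy]; abel
  -- Since `w * (1 - v * w) = 0`, applying `w` to the zero output isolates the new state.
  have hx₂ : x₂ = 0 := by
    have := congrArg (w *ᵥ ·) h₃
    simpa [mulVec_add, mulVec_mulVec, Matrix.mul_sub, ← Matrix.mul_assoc, hwv] using this
  subst hx₂
  have hwy : w *ᵥ y = 0 := by simpa using h₂
  have hy0 : y = 0 := by
    simpa [sub_mulVec, ← mulVec_mulVec, hwy] using h₃
  obtain ⟨rfl, rfl⟩ := h x₁ u h₁ hy0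
  simp

/-- Replacing `B` by `B + (A + a - 1) B v w`, where `C B v = 0`, can only create the zero `-a`. -/
theorem PencilInjective.update_input [DecidableEq ι] {A : Matrix ι ι K} {B : Matrix ι κ K}
    {C : Matrix ρ ι K} {s : K} (h : PencilInjective A B C (0 : Matrix ρ κ K) s) {a : K}
    (hs : s + a ≠ 0) {v : Matrix κ Unit K} {w : Matrix Unit κ K} (hwv : w * v = 1)
    (hCBv : C * (B * v) = 0) :
    PencilInjective A (B + (A + (a - 1) • 1) * (B * v) * w) C (0 : Matrix ρ κ K) s := by
  intro x u hx hy
  set t := w *ᵥ u with ht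
  have hx' : A *ᵥ x + B *ᵥ u + (A *ᵥ B *ᵥ v *ᵥ t + (a - 1) • B *ᵥ v *ᵥ t) = s • x := by
    rw [← hx]
    simp [add_mulVec, ← mulVec_mulVec, smul_mulVec, ht, add_assoc]
  have hC : C *ᵥ B *ᵥ v *ᵥ t = 0 := by
    rw [mulVec_mulVec, mulVec_mulVec, Matrix.mul_assoc, hCBv, zero_mulVec]
  -- The shift of `x` absorbs the term `A B v t`; the shift of `u` balances the remaining multiples
  -- of `B v t`.
  obtain ⟨h₁, h₂⟩ := h (x + B *ᵥ v *ᵥ t) (u + (s + a - 1) • v *ᵥ t)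
    (by
      simp only [mulVec_add, mulVec_smul]
      ext i
      have := congrFun hx' i
      simp at this ⊢
      linear_combination this)
    (by rw [mulVec_add, hC, add_zero, zero_mulVec]; simpa using hy)
  have ht0 : t = 0 := by
    have := congrArg (w *ᵥ ·) h₂
    simp only [mulVec_add, mulVec_smul, mulVec_mulVec, hwv, ← ht, one_mulVec, mulVec_zero] at this
    have h' : (s + a) • t = 0 := by
      rw [← this]; module
    exact (smul_eq_zero.mp h').resolve_left hs
  simp only [ht0, mulVec_zero, smul_zero, add_zero] at h₁ h₂
  exact ⟨h₁, h₂⟩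

end Field

/-- Controllability, in terms of the left annihilator of all the blocks `A ^ k * B`. -/
def InputsSpan {K ι κ : Type*} [Field K] [Fintype ι] [DecidableEq ι] (A : Matrix ι ι K)
    (B : Matrix ι κ K) : Prop :=
  ∀ q, (∀ k : ℕ, q ᵥ* (A ^ k * B) = 0) → q = 0

/-- The new input matrix sends `v` to `(A + a) b`, so `q` annihilates every `A ^ k (A + a) b`.
Removing these terms shows that `q (A + a)` annihilates every `A ^ k B`; hence it vanishes, and
invertibility of `A + a` gives `q = 0`. -/
theorem InputsSpan.update_input {K ι κ : Type*} [Field K] [Fintype ι] [DecidableEq ι] [Fintype κ]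
    {A : Matrix ι ι K} {B : Matrix ι κ K} (h : InputsSpan A B) {a : K}
    (ha : IsUnit (A + a • (1 : Matrix ι ι K)))
    {v : Matrix κ Unit K} {w : Matrix Unit κ K} (hwv : w * v = 1) :
    InputsSpan A (B + (A + (a - 1) • 1) * (B * v) * w) := by
  intro q hq
  set b := B * v with hb
  have hB : B + (A + (a - 1) • 1) * b * w = B + ((A + a • 1) * b - b) * w := by
    congr 2
    rw [sub_smul, one_smul, ← add_sub_assoc, Matrix.sub_mul, Matrix.one_mul]
  rw [hB] at hq
  have hbq : ∀ k : ℕ, q ᵥ* (A ^ k * ((A + a • 1) * b)) = 0 := by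
    intro k
    have := congrArg (· ᵥ* v) (hq k)
    simp only [vecMul_vecMul, zero_vecMul] at this
    rw [← this, Matrix.mul_assoc, Matrix.add_mul B, Matrix.mul_assoc _ w v, hwv, Matrix.mul_one,
      ← hb, add_sub_cancel]
  have hcomm : ∀ k : ℕ, A ^ k * (A + a • 1) = (A + a • 1) * A ^ k := fun k => by
    simp [Matrix.mul_add, Matrix.add_mul, ← pow_succ, ← pow_succ']
  have key : q ᵥ* (A + a • 1) = 0 := by
    apply h
    intro k
    have h0 := hq k
    have h1 := hq (k + 1)
    have h2 := hbq k
    have h3 := hbq (k + 1)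
    have e : (A + a • 1) * (A ^ k * B) =
        (A ^ (k + 1) * (B + ((A + a • 1) * b - b) * w)
          + a • (A ^ k * (B + ((A + a • 1) * b - b) * w)))
        - (A ^ (k + 1) * ((A + a • 1) * b) * w + a • (A ^ k * ((A + a • 1) * b) * w)
          - A ^ k * ((A + a • 1) * b) * w) := by
      rw [← Matrix.mul_assoc, ← hcomm]
      simp only [Matrix.add_mul, Matrix.mul_add, Matrix.sub_mul, Matrix.mul_sub, Matrix.smul_mul,
        Matrix.mul_smul, Matrix.one_mul, Matrix.mul_one, pow_succ, Matrix.mul_assoc]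
      module
    rw [vecMul_vecMul, e, vecMul_sub, vecMul_sub, vecMul_add, vecMul_add, vecMul_smul, vecMul_smul,
      h0, h1, ← vecMul_vecMul _ _ w, ← vecMul_vecMul _ _ w, h2, h3]
    simp
  exact (vecMul_injective_iff_isUnit.mpr ha) (by simpa using key)

/-! ### Linear algebra preliminaries. -/

theorem rank_eq_card_iff {K ι κ : Type*} [Field K] [Fintype ι] [Fintype κ] (M : Matrix ι κ K) :
    M.rank = Fintype.card κ ↔ ∀ x, M *ᵥ x = 0 → x = 0 := by
  have h := LinearMap.finrank_range_add_finrank_ker M.mulVecLin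
  rw [Module.finrank_fintype_fun_eq_card] at h
  have h' : (∀ x, M *ᵥ x = 0 → x = 0) ↔ LinearMap.ker M.mulVecLin = ⊥ := by
    rw [LinearMap.ker_eq_bot']; rfl
  rw [h', ← Submodule.finrank_eq_zero, Matrix.rank]
  omega

theorem isUnit_X_sub_map {ι : Type*} [Fintype ι] [DecidableEq ι] (A : Matrix ι ι ℝ) :
    IsUnit (Matrix.scalar ι (RatFunc.X : RatFunc ℝ) - A.map (algebraMap ℝ (RatFunc ℝ))) := by
  rw [Matrix.isUnit_iff_isUnit_det, ← Matrix.eval_charpoly, Matrix.charpoly_map,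
    Polynomial.eval_map_algebraMap, RatFunc.aeval_X_left_eq_algebraMap, isUnit_iff_ne_zero]
  exact RatFunc.algebraMap_ne_zero A.charpoly_monic.ne_zero

theorem scalar_sub_mulVec {K ι : Type*} [Field K] [Fintype ι] [DecidableEq ι] (s : K)
    (A : Matrix ι ι K) (x : ι → K) : (Matrix.scalar ι s - A) *ᵥ x = s • x - A *ᵥ x := by
  rw [sub_mulVec, Matrix.scalar_apply, ← Matrix.smul_one_eq_diagonal, smul_mulVec, one_mulVec]

theorem exists_mul_eq_one_of_injective {ι κ : Type*} [Fintype ι] [DecidableEq ι] [Fintype κ]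
    [DecidableEq κ] {T : Matrix ι κ ℝ} (hT : ∀ x, T *ᵥ x = 0 → x = 0) :
    ∃ L : Matrix κ ι ℝ, L * T = 1 := by
  obtain ⟨g, hg⟩ := LinearMap.exists_leftInverse_of_injective (Matrix.toLin' T)
    (LinearMap.ker_eq_bot'.mpr hT)
  refine ⟨LinearMap.toMatrix' g, ?_⟩
  rw [← LinearMap.toMatrix'_toLin' T, ← LinearMap.toMatrix'_comp, hg, LinearMap.toMatrix'_id]

theorem fromCols_add_fromCols {K ι κ κ' : Type*} [Add K] (A A' : Matrix ι κ K)
    (B B' : Matrix ι κ' K) :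
    fromCols A B + fromCols A' B' = fromCols (A + A') (B + B') := by
  ext i (j | j) <;> simp

theorem reassoc_of_mul_eq_one {K ι κ ρ : Type*} [Ring K] [Fintype ι] [Fintype κ] [DecidableEq κ]
    {w : Matrix κ ι K} {v : Matrix ι κ K} (h : w * v = 1) (M : Matrix κ ρ K) :
    w * (v * M) = M := by
  rw [← Matrix.mul_assoc, h, Matrix.one_mul]

/-! ### The cascade invariant and its extension by one state. -/

/-- `(A, B, C)` is the cascade of the stable system `(Az, Bz, Cz, Dz)`, which has no finite zeros,
with `(A, Bb, C)`, up to the coordinate change given by the injective matrix `T`; passing from `B`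
to `Bb` preserves controllability and creates no zeros other than `-a`. -/
structure IsCascade {ν μ ρ ι : Type*} [Fintype ν] [DecidableEq ν] [Fintype μ] [Fintype ι] (a : ℝ)
    (A : Matrix ν ν ℝ) (B : Matrix ν μ ℝ) (C : Matrix ρ ν ℝ) (Az : Matrix ι ι ℝ)
    (Bz : Matrix ι μ ℝ) (Cz : Matrix μ ι ℝ) (Dz : Matrix μ μ ℝ) (Bb : Matrix ν μ ℝ)
    (T : Matrix ν ι ℝ) : Prop where
  stable : ∀ s : ℂ, 0 ≤ s.re → ∀ x, Az.map (algebraMap ℝ ℂ) *ᵥ x = s • x → x = 0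
  -- Needed over `ℂ` for pointwise zeros and over `RatFunc ℝ`, at `s = X`, for normal rank.
  pencil : ∀ (K : Type) [Field K] [Algebra ℝ K] (s : K),
    PencilInjective (Az.map (algebraMap ℝ K)) (Bz.map (algebraMap ℝ K)) (Cz.map (algebraMap ℝ K))
      (Dz.map (algebraMap ℝ K)) s
  state : A * T = T * Az + Bb * Cz
  output : C * T = 0
  input : B = T * Bz + Bb * Dz
  injective : ∀ x, T *ᵥ x = 0 → x = 0
  span : InputsSpan A Bb
  zeros : ∀ (K : Type) [Field K] [Algebra ℝ K] (s : K), s + algebraMap ℝ K a ≠ 0 →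
    PencilInjective (A.map (algebraMap ℝ K)) (B.map (algebraMap ℝ K)) (C.map (algebraMap ℝ K)) 0 s →
    PencilInjective (A.map (algebraMap ℝ K)) (Bb.map (algebraMap ℝ K)) (C.map (algebraMap ℝ K)) 0 s

section

variable {ν μ ρ ι : Type*} [Fintype ν] [DecidableEq ν] [Fintype μ] [Fintype ι]
  {a : ℝ} {A : Matrix ν ν ℝ} {B : Matrix ν μ ℝ}
  {C : Matrix ρ ν ℝ} {Az : Matrix ι ι ℝ} {Bz : Matrix ι μ ℝ} {Cz : Matrix μ ι ℝ}
  {Dz : Matrix μ μ ℝ} {Bb : Matrix ν μ ℝ} {T : Matrix ν ι ℝ}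

theorem isCascade_refl [DecidableEq μ] (h : InputsSpan A B) :
    IsCascade a A B C (0 : Matrix (Fin 0) (Fin 0) ℝ) 0 0 (1 : Matrix μ μ ℝ) B 0 where
  stable _ _ _ _ := Subsingleton.elim _ _
  pencil K _ _ s x u _ hu := by
    refine ⟨Subsingleton.elim _ _, ?_⟩
    simpa [Matrix.map_one] using hu
  state := by simp
  output := by simp
  input := by simp
  injective _ _ := Subsingleton.elim _ _
  span := h
  zeros _ _ _ _ _ h := h

theorem IsCascade.reindex (h : IsCascade a A B C Az Bz Cz Dz Bb T) {κ : Type*} [Fintype κ]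
    (e : κ ≃ ι) :
    IsCascade a A B C (Az.submatrix e e) (Bz.submatrix e id) (Cz.submatrix id e) Dz Bb
      (T.submatrix id e) where
  stable s hs x hx := by
    rw [← submatrix_map, submatrix_mulVec_equiv] at hx
    have := h.stable s hs (x ∘ e.symm) (by
      ext i; simpa using congrFun hx (e.symm i))
    ext i; simpa using congrFun this (e i)
  pencil K _ _ s x u hx hu := by
    rw [← submatrix_map, submatrix_mulVec_equiv] at hx hu
    obtain ⟨h₁, h₂⟩ := h.pencil K s (x ∘ e.symm) u
      (by
        ext i
        simpa [Matrix.mulVec, dotProduct] using congrFun hx (e.symm i))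
      (by simpa using hu)
    refine ⟨?_, h₂⟩
    ext i; simpa using congrFun h₁ (e i)
  state := by
    have h₁ := congrArg (·.submatrix id e) h.state
    simp only [submatrix_add, Pi.add_apply] at h₁
    rw [submatrix_mul_equiv, ← Matrix.submatrix_mul_equiv A T id (Equiv.refl _) e,
      ← Matrix.submatrix_mul_equiv Bb Cz id (Equiv.refl _) e] at *
    simpa using h₁
  output := by
    have h₁ := congrArg (·.submatrix id e) h.output
    rw [← Matrix.submatrix_mul_equiv C T id (Equiv.refl _) e] at h₁
    simpa using h₁
  input := by
    rw [submatrix_mul_equiv]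
    simpa using h.input
  injective x hx := by
    rw [submatrix_mulVec_equiv] at hx
    have := h.injective (x ∘ e.symm) (by simpa using hx)
    ext i; simpa using congrFun this (e i)
  span := h.span
  zeros := h.zeros

variable [DecidableEq μ] [DecidableEq ι]

theorem IsCascade.extend (h : IsCascade a A B C Az Bz Cz Dz Bb T) (ha : 0 < a)
    (hA : IsUnit (A + a • (1 : Matrix ν ν ℝ)))
    (hX : PencilInjective (A.map (algebraMap ℝ (RatFunc ℝ))) (B.map (algebraMap ℝ (RatFunc ℝ)))
      (C.map (algebraMap ℝ (RatFunc ℝ))) 0 RatFunc.X)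
    {v : Matrix μ Unit ℝ} {w : Matrix Unit μ ℝ} (hwv : w * v = 1) (hCBv : C * (Bb * v) = 0) :
    IsCascade a A B C (fromBlocks Az 0 (w * Cz) (-a • (1 : Matrix Unit Unit ℝ)))
      (fromRows Bz (w * Dz)) (fromCols ((1 - v * w) * Cz) v) ((1 - v * w) * Dz)
      (Bb + (A + (a - 1) • 1) * (Bb * v) * w) (fromCols T (Bb * v)) where
  stable s hs x hx := by
    obtain ⟨x₁, x₂, rfl⟩ : ∃ x₁ x₂, x = Sum.elim x₁ x₂ := ⟨x ∘ Sum.inl, x ∘ Sum.inr, by simp⟩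
    rw [fromBlocks_map, fromBlocks_mulVec] at hx
    have h₁ : x₁ = 0 := h.stable s hs x₁ (by
      ext i; simpa [Matrix.map_zero] using congrFun hx (Sum.inl i))
    subst h₁
    have h₂ : (s + a) • x₂ = 0 := by
      ext i
      have := congrFun hx (Sum.inr i)
      rw [Matrix.map_smul' _ _ _ (map_mul _)] at this
      simp [Matrix.map_one, smul_mulVec, neg_mulVec] at this
      simp only [Pi.smul_apply, smul_eq_mul, Pi.zero_apply]
      linear_combination -this
    have hsa : s + a ≠ 0 := fun h0 => by
      have := congrArg Complex.re h0
      simp at this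
      linarith
    rw [(smul_eq_zero.mp h₂).resolve_left hsa]
    simp
  pencil K _ _ s := by
    have hwv' : w.map (algebraMap ℝ K) * v.map (algebraMap ℝ K) = 1 := by
      rw [← Matrix.map_mul, hwv, Matrix.map_one _ (map_zero _) (map_one _)]
    convert (h.pencil K s).cascade (algebraMap ℝ K a) hwv' using 1
    · ext (i | i) (j | j) <;> simp [← Matrix.map_mul, Algebra.algebraMap_eq_smul_one]
    · ext (i | i) j <;> simp [← Matrix.map_mul]
    · simp [Matrix.map_mul, Matrix.map_sub, Matrix.map_one, fromCols_map]
    · simp [Matrix.map_mul, Matrix.map_sub, Matrix.map_one]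
  state := by
    rw [mul_fromCols, fromCols_mul_fromBlocks, mul_fromCols, h.state, fromCols_add_fromCols]
    congr 1
    · simp only [Matrix.mul_sub, Matrix.sub_mul, Matrix.add_mul, Matrix.mul_assoc,
        reassoc_of_mul_eq_one hwv, Matrix.one_mul, Matrix.smul_mul]
      abel
    · simp only [Matrix.add_mul, Matrix.mul_assoc, hwv, Matrix.mul_one, Matrix.one_mul,
        Matrix.smul_mul, Matrix.mul_smul, Matrix.mul_zero]
      module
  output := by
    rw [mul_fromCols, h.output, hCBv, fromCols_zero]
  input := by
    rw [fromCols_mul_fromRows]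
    conv_lhs => rw [h.input]
    simp only [Matrix.mul_sub, Matrix.sub_mul, Matrix.add_mul, Matrix.mul_assoc,
      reassoc_of_mul_eq_one hwv, Matrix.one_mul, Matrix.smul_mul]
    abel
  injective x hx := by
    obtain ⟨x₁, x₂, rfl⟩ : ∃ x₁ x₂, x = Sum.elim x₁ x₂ := ⟨x ∘ Sum.inl, x ∘ Sum.inr, by simp⟩
    rw [fromCols_mulVec_sumElim] at hx
    obtain ⟨L, hL⟩ := exists_mul_eq_one_of_injective h.injective
    obtain ⟨R, hR⟩ := (isUnit_X_sub_map Az).exists_right_inv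
    let f := algebraMap ℝ (RatFunc ℝ)
    -- `ξ = (X - Az)⁻¹ x₁`. A relation `T x₁ + Bb v x₂ = 0` makes `(T ξ, -(Cz ξ + v x₂))` a kernel
    -- vector of the pencil of `(A, Bb, C)` at `X`, which is injective there.
    let ξ : ι → RatFunc ℝ := R *ᵥ (f ∘ x₁)
    have hξ : Az.map f *ᵥ ξ = (RatFunc.X : RatFunc ℝ) • ξ - f ∘ x₁ := by
      have : (Matrix.scalar ι (RatFunc.X : RatFunc ℝ) - Az.map f) *ᵥ ξ = f ∘ x₁ := by
        rw [mulVec_mulVec, hR, one_mulVec]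
      rw [← this, scalar_sub_mulVec, sub_sub_cancel]
    have hx' : T.map f *ᵥ (f ∘ x₁) + Bb.map f *ᵥ v.map f *ᵥ (f ∘ x₂) = 0 := by
      ext i
      have := congrArg f (congrFun hx i)
      rw [mulVec_mulVec, ← Matrix.map_mul]
      simpa [RingHom.map_mulVec] using this
    have hst : A.map f * T.map f = T.map f * Az.map f + Bb.map f * Cz.map f := by
      rw [← Matrix.map_mul, h.state]; simp [Matrix.map_add, Matrix.map_mul]
    have hCT : C.map f * T.map f = 0 := by
      rw [← Matrix.map_mul, h.output]; simp [Matrix.map_zero]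
    have hsa : (RatFunc.X : RatFunc ℝ) + f a ≠ 0 := by
      change (RatFunc.X : RatFunc ℝ) + algebraMap ℝ (RatFunc ℝ) a ≠ 0
      rw [RatFunc.algebraMap_eq_C, ← RatFunc.algebraMap_X, ← RatFunc.algebraMap_C, ← map_add]
      exact RatFunc.algebraMap_ne_zero (Polynomial.X_add_C_ne_zero a)
    obtain ⟨h₁, h₂⟩ := h.zeros _ RatFunc.X hsa hX (T.map f *ᵥ ξ)
      (-(Cz.map f *ᵥ ξ + v.map f *ᵥ (f ∘ x₂)))
      (by
        rw [mulVec_mulVec, hst, add_mulVec, ← mulVec_mulVec, hξ, mulVec_sub, mulVec_smul,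
          ← mulVec_mulVec, mulVec_neg, mulVec_add, ← sub_eq_zero, ← neg_eq_zero, ← hx']
        abel)
      (by rw [mulVec_mulVec, hCT]; simp)
    have hξ0 : ξ = 0 := by
      have := congrArg (L.map f *ᵥ ·) h₁
      simpa [mulVec_mulVec, ← Matrix.map_mul, hL, Matrix.map_one] using this
    -- `x₁ = (X - Az) ξ`, and constants embed in `RatFunc ℝ`.
    have hx₁ : x₁ = 0 := by
      rw [hξ0] at hξ
      ext i
      have := congrFun hξ i
      simpa using this
    have hx₂ : x₂ = 0 := by
      rw [hx₁] at hx
      rw [hξ0] at h₂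
      have := congrArg (w.map f *ᵥ ·) h₂
      simp [mulVec_mulVec, ← Matrix.map_mul, hwv, Matrix.map_one, mulVec_neg] at this
      ext i
      have := congrFun this i
      simpa using this
    simp [hx₁, hx₂]
  span := h.span.update_input hA hwv
  zeros K _ _ s hs h0 := by
    have hwv' : w.map (algebraMap ℝ K) * v.map (algebraMap ℝ K) = 1 := by
      rw [← Matrix.map_mul, hwv, Matrix.map_one _ (map_zero _) (map_one _)]
    have hC' : C.map (algebraMap ℝ K) * (Bb.map (algebraMap ℝ K) * v.map (algebraMap ℝ K)) = 0 := by
      rw [← Matrix.map_mul, ← Matrix.map_mul, hCBv, Matrix.map_zero _ (map_zero _)]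
    convert (h.zeros K s hs h0).update_input hs hwv' hC' using 1
    rw [Matrix.map_add _ (map_add _), Matrix.map_mul, Matrix.map_mul, Matrix.map_mul,
      Matrix.map_add _ (map_add _)]
    congr 4
    ext i j
    simp [Matrix.one_apply, apply_ite (algebraMap ℝ K)]

end

/-! ### Rank conditions and transfer matrices in terms of kernels. -/

theorem inputsSpan_of_isControllable {n m : ℕ} {A : Matrix (Fin n) (Fin n) ℝ}
    {B : Matrix (Fin n) (Fin m) ℝ} (h : IsControllable A B) : InputsSpan A B := by
  intro q hq
  rw [IsControllable, ← Matrix.rank_transpose] at h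
  refine (rank_eq_card_iff _).mp (h.trans (Fintype.card_fin n).symm) q ?_
  ext ⟨k, j⟩
  simpa [Matrix.mulVec, vecMul, dotProduct, mul_comm] using congrFun (hq k) j

theorem InputsSpan.isControllable {n m : ℕ} {A : Matrix (Fin n) (Fin n) ℝ}
    {B : Matrix (Fin n) (Fin m) ℝ} (h : InputsSpan A B) : IsControllable A B := by
  rw [IsControllable, ← Matrix.rank_transpose]
  refine Eq.trans ((rank_eq_card_iff _).mpr fun q hq => h q fun k => ?_) (Fintype.card_fin n)
  have hlt : ∀ i : Fin n, q ᵥ* (A ^ (i : ℕ) * B) = 0 := fun i => by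
    ext j
    simpa [Matrix.mulVec, vecMul, dotProduct, mul_comm] using congrFun hq (i, j)
  rcases Nat.eq_zero_or_pos n with rfl | hn
  · rw [Subsingleton.elim q 0, zero_vecMul]
  have : Nonempty (Fin n) := ⟨⟨0, hn⟩⟩
  -- By Cayley–Hamilton, `A ^ k` is a combination of powers below `n`.
  have hdeg : (Polynomial.X ^ k %ₘ A.charpoly).natDegree < n := by
    have := Polynomial.natDegree_modByMonic_lt (Polynomial.X ^ k) A.charpoly_monic (by
      intro h1
      have := A.charpoly_natDegree_eq_dim
      rw [h1, Polynomial.natDegree_one, Fintype.card_fin] at this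
      omega)
    rwa [A.charpoly_natDegree_eq_dim, Fintype.card_fin] at this
  rw [Matrix.pow_eq_aeval_mod_charpoly, Polynomial.aeval_eq_sum_range' hdeg, Matrix.sum_mul,
    vecMul_sum]
  refine Finset.sum_eq_zero fun i hi => ?_
  rw [Matrix.smul_mul, vecMul_smul, hlt ⟨i, Finset.mem_range.mp hi⟩, smul_zero]

theorem systemMatrix_mulVec_eq_zero {n m p : ℕ} (A : Matrix (Fin n) (Fin n) ℝ)
    (B : Matrix (Fin n) (Fin m) ℝ) (C : Matrix (Fin p) (Fin n) ℝ) (D : Matrix (Fin p) (Fin m) ℝ)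
    (s : ℂ) (x : Fin n → ℂ) (u : Fin m → ℂ) :
    systemMatrix A B C D s *ᵥ Sum.elim x u = 0 ↔
      A.map (algebraMap ℝ ℂ) *ᵥ x + B.map (algebraMap ℝ ℂ) *ᵥ u = s • x ∧
        C.map (algebraMap ℝ ℂ) *ᵥ x + D.map (algebraMap ℝ ℂ) *ᵥ u = 0 := by
  have e : (-Matrix.scalar (Fin n) s + A.map (algebraMap ℝ ℂ)) *ᵥ x =
      A.map (algebraMap ℝ ℂ) *ᵥ x - s • x := by
    rw [neg_add_eq_sub, ← neg_sub, neg_mulVec, scalar_sub_mulVec, neg_sub]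
  rw [systemMatrix, fromBlocks_mulVec, Sum.elim_comp_inl, Sum.elim_comp_inr, e,
    ← Sum.elim_zero_zero, Sum.elim_eq_iff, ← sub_eq_zero (b := s • x), add_sub_right_comm]

theorem pencilInjective_iff {n m p : ℕ} (A : Matrix (Fin n) (Fin n) ℝ)
    (B : Matrix (Fin n) (Fin m) ℝ) (C : Matrix (Fin p) (Fin n) ℝ) (D : Matrix (Fin p) (Fin m) ℝ)
    (s : ℂ) :
    PencilInjective (A.map (algebraMap ℝ ℂ)) (B.map (algebraMap ℝ ℂ)) (C.map (algebraMap ℝ ℂ))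
      (D.map (algebraMap ℝ ℂ)) s ↔ ∀ x, systemMatrix A B C D s *ᵥ x = 0 → x = 0 := by
  constructor
  · intro h x hx
    rw [← Sum.elim_comp_inl_inr x] at hx ⊢
    obtain ⟨h₁, h₂⟩ := (systemMatrix_mulVec_eq_zero ..).mp hx
    obtain ⟨h₁, h₂⟩ := h _ _ h₁ h₂
    rw [h₁, h₂, Sum.elim_zero_zero]
  · intro h x u h₁ h₂
    have := h (Sum.elim x u) ((systemMatrix_mulVec_eq_zero ..).mpr ⟨h₁, h₂⟩)
    rwa [← Sum.elim_zero_zero, Sum.elim_eq_iff] at this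

theorem not_isTransmissionZero_iff {n m p : ℕ} (hmp : m ≤ p) (A : Matrix (Fin n) (Fin n) ℝ)
    (B : Matrix (Fin n) (Fin m) ℝ) (C : Matrix (Fin p) (Fin n) ℝ) (D : Matrix (Fin p) (Fin m) ℝ)
    (s : ℂ) :
    ¬ IsTransmissionZero A B C D s ↔
      PencilInjective (A.map (algebraMap ℝ ℂ)) (B.map (algebraMap ℝ ℂ)) (C.map (algebraMap ℝ ℂ))
        (D.map (algebraMap ℝ ℂ)) s := by
  rw [pencilInjective_iff, ← rank_eq_card_iff, IsTransmissionZero, min_eq_left hmp, not_lt]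
  have := (systemMatrix A B C D s).rank_le_card_width
  simp only [Fintype.card_sum, Fintype.card_fin] at this ⊢
  omega

section transferMatrix

variable {n m p : ℕ} {A : Matrix (Fin n) (Fin n) ℝ} {B : Matrix (Fin n) (Fin m) ℝ}
  {C : Matrix (Fin p) (Fin n) ℝ} {D : Matrix (Fin p) (Fin m) ℝ}

/-- The kernel of the pencil at the generic point is the kernel of the transfer matrix. -/
theorem pencilInjective_X_iff :
    PencilInjective (A.map (algebraMap ℝ (RatFunc ℝ))) (B.map (algebraMap ℝ (RatFunc ℝ)))
      (C.map (algebraMap ℝ (RatFunc ℝ))) (D.map (algebraMap ℝ (RatFunc ℝ))) RatFunc.X ↔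
    ∀ u, transferMatrix A B C D *ᵥ u = 0 → u = 0 := by
  have hdet := (Matrix.isUnit_iff_isUnit_det _).mp (isUnit_X_sub_map A)
  have key : ∀ x u, A.map (algebraMap ℝ (RatFunc ℝ)) *ᵥ x +
        B.map (algebraMap ℝ (RatFunc ℝ)) *ᵥ u = (RatFunc.X : RatFunc ℝ) • x ↔
      x = (Matrix.scalar (Fin n) (RatFunc.X : RatFunc ℝ) -
        A.map (algebraMap ℝ (RatFunc ℝ)))⁻¹ *ᵥ B.map (algebraMap ℝ (RatFunc ℝ)) *ᵥ u := by
    intro x u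
    rw [eq_comm, ← sub_eq_iff_eq_add', ← scalar_sub_mulVec]
    constructor
    · intro h
      rw [← h, mulVec_mulVec, Matrix.nonsing_inv_mul _ hdet, one_mulVec]
    · rintro rfl
      rw [mulVec_mulVec, Matrix.mul_nonsing_inv _ hdet, one_mulVec]
  constructor
  · intro h u hu
    refine (h _ u ((key _ u).mpr rfl) ?_).2
    simpa [transferMatrix, add_mulVec, ← mulVec_mulVec] using hu
  · intro h x u hx hu
    rw [key] at hx
    have : u = 0 := h u (by
      rw [hx] at hu
      simpa [transferMatrix, add_mulVec, ← mulVec_mulVec] using hu)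
    exact ⟨by rw [hx, this]; simp, this⟩

end transferMatrix

/-- The transfer matrix of a cascade is the product of the transfer matrices. -/
theorem transferMatrix_mul_of_cascade {n m p k : ℕ} {A : Matrix (Fin n) (Fin n) ℝ}
    {B Bb : Matrix (Fin n) (Fin m) ℝ} {C : Matrix (Fin p) (Fin n) ℝ}
    {Az : Matrix (Fin k) (Fin k) ℝ} {Bz : Matrix (Fin k) (Fin m) ℝ} {Cz : Matrix (Fin m) (Fin k) ℝ}
    {Dz : Matrix (Fin m) (Fin m) ℝ} {T : Matrix (Fin n) (Fin k) ℝ}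
    (state : A * T = T * Az + Bb * Cz) (output : C * T = 0) (input : B = T * Bz + Bb * Dz) :
    transferMatrix A Bb C 0 * transferMatrix Az Bz Cz Dz = transferMatrix A B C 0 := by
  simp only [transferMatrix]
  set f := algebraMap ℝ (RatFunc ℝ)
  set P := Matrix.scalar (Fin n) (RatFunc.X : RatFunc ℝ) - A.map f with hP
  set Q := Matrix.scalar (Fin k) (RatFunc.X : RatFunc ℝ) - Az.map f with hQ
  have hPu : IsUnit P.det := (Matrix.isUnit_iff_isUnit_det _).mp (isUnit_X_sub_map A)
  have hQu : IsUnit Q.det := (Matrix.isUnit_iff_isUnit_det _).mp (isUnit_X_sub_map Az)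
  have hst : Bb.map f * Cz.map f = T.map f * Q - P * T.map f := by
    have h := congrArg (fun M => M.map f) state
    simp only [Matrix.map_mul, Matrix.map_add _ (map_add f)] at h
    have hX : T.map f * Matrix.scalar (Fin k) (RatFunc.X : RatFunc ℝ) =
        Matrix.scalar (Fin n) (RatFunc.X : RatFunc ℝ) * T.map f := by
      ext i j
      simp [mul_comm]
    rw [hP, hQ, Matrix.mul_sub, Matrix.sub_mul, hX, h]
    abel
  have hout : C.map f * T.map f = 0 := by
    rw [← Matrix.map_mul, output, Matrix.map_zero _ (map_zero f)]
  have hin : B.map f = T.map f * Bz.map f + Bb.map f * Dz.map f := by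
    rw [input, Matrix.map_add _ (map_add f), Matrix.map_mul, Matrix.map_mul]
  -- A resolvent identity from the Sylvester equation `state`; `C * T = 0` kills its last term.
  have hres : P⁻¹ * (Bb.map f * Cz.map f) * Q⁻¹ = P⁻¹ * T.map f - T.map f * Q⁻¹ := by
    rw [hst, Matrix.mul_sub, Matrix.sub_mul, Matrix.mul_assoc, Matrix.mul_assoc (T.map f),
      Matrix.mul_nonsing_inv _ hQu, Matrix.mul_one, ← Matrix.mul_assoc P⁻¹ P,
      Matrix.nonsing_inv_mul _ hPu, Matrix.one_mul]
  rw [Matrix.map_zero _ (map_zero f), add_zero, add_zero, hin]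
  calc _ = C.map f * (P⁻¹ * (Bb.map f * Cz.map f) * Q⁻¹) * Bz.map f
        + C.map f * P⁻¹ * Bb.map f * Dz.map f := by
        simp only [Matrix.mul_add, Matrix.mul_assoc]
    _ = _ := by
        rw [hres, Matrix.mul_sub, ← Matrix.mul_assoc, ← Matrix.mul_assoc _ _ Q⁻¹, hout,
          Matrix.zero_mul, sub_zero, Matrix.mul_add]
        simp only [Matrix.mul_assoc]

/-! ### Choice of `a`, iteration and conclusion. -/

theorem exists_pos_isUnit_add_smul_one {ι : Type*} [Fintype ι] [DecidableEq ι]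
    (A : Matrix ι ι ℝ) : ∃ a : ℝ, 0 < a ∧ IsUnit (A + a • (1 : Matrix ι ι ℝ)) := by
  obtain ⟨a, ha, hs⟩ := (Set.Ioi_infinite (0 : ℝ)).exists_notMem_finite
    (Matrix.finite_spectrum (-A))
  refine ⟨a, ha, ?_⟩
  rw [spectrum.notMem_iff, Algebra.algebraMap_eq_smul_one, sub_neg_eq_add, add_comm] at hs
  exact hs

theorem isHurwitz_of_forall_eigenvector {n : ℕ} {A : Matrix (Fin n) (Fin n) ℝ}
    (h : ∀ s : ℂ, 0 ≤ s.re → ∀ x, A.map (algebraMap ℝ ℂ) *ᵥ x = s • x → x = 0) :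
    IsHurwitz A := by
  intro s hs
  by_contra hre
  rw [spectrum.mem_iff, Matrix.isUnit_iff_isUnit_det, isUnit_iff_ne_zero, not_not,
    ← Matrix.exists_mulVec_eq_zero_iff] at hs
  obtain ⟨x, hx, hx0⟩ := hs
  refine hx (h s (not_lt.mp hre) x ?_)
  rw [Algebra.algebraMap_eq_smul_one, sub_mulVec, smul_mulVec, one_mulVec, sub_eq_zero] at hx0
  exact hx0.symm

/-- As long as `C Bb` is rank deficient, a cascade can be extended by a first-order factor. -/
theorem exists_isCascade_of_rank_lt {n m p : ℕ} {a : ℝ} {A : Matrix (Fin n) (Fin n) ℝ}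
    {B : Matrix (Fin n) (Fin m) ℝ} {C : Matrix (Fin p) (Fin n) ℝ} (ha : 0 < a)
    (hA : IsUnit (A + a • (1 : Matrix (Fin n) (Fin n) ℝ))) (hspan : InputsSpan A B)
    (hX : PencilInjective (A.map (algebraMap ℝ (RatFunc ℝ))) (B.map (algebraMap ℝ (RatFunc ℝ)))
      (C.map (algebraMap ℝ (RatFunc ℝ))) 0 RatFunc.X)
    (hdef : ∀ (k : ℕ) (Az : Matrix (Fin k) (Fin k) ℝ) (Bz : Matrix (Fin k) (Fin m) ℝ)
      (Cz : Matrix (Fin m) (Fin k) ℝ) (Dz : Matrix (Fin m) (Fin m) ℝ)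
      (Bb : Matrix (Fin n) (Fin m) ℝ) (T : Matrix (Fin n) (Fin k) ℝ),
      IsCascade a A B C Az Bz Cz Dz Bb T → (C * Bb).rank < m) (k : ℕ) :
    ∃ (Az : Matrix (Fin k) (Fin k) ℝ) (Bz : Matrix (Fin k) (Fin m) ℝ)
      (Cz : Matrix (Fin m) (Fin k) ℝ) (Dz : Matrix (Fin m) (Fin m) ℝ)
      (Bb : Matrix (Fin n) (Fin m) ℝ) (T : Matrix (Fin n) (Fin k) ℝ),
      IsCascade a A B C Az Bz Cz Dz Bb T := by
  induction k with
  | zero => exact ⟨_, _, _, _, _, _, isCascade_refl hspan⟩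
  | succ k ih =>
    obtain ⟨Az, Bz, Cz, Dz, Bb, T, h⟩ := ih
    have hlt := hdef _ _ _ _ _ _ _ h
    have : ¬ ∀ x, (C * Bb) *ᵥ x = 0 → x = 0 := by
      rw [← rank_eq_card_iff, Fintype.card_fin]; exact hlt.ne
    push Not at this
    obtain ⟨x, hx, hx0⟩ := this
    have hxx : x ⬝ᵥ x ≠ 0 := fun h0 => hx0 (dotProduct_self_eq_zero.mp h0)
    -- With `v = x` a kernel vector of `C * Bb`, the row `w = xᵀ / (x ⬝ᵥ x)` is a left inverse.
    have hwv : replicateRow Unit ((x ⬝ᵥ x)⁻¹ • x) * replicateCol Unit x = 1 := by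
      ext i j
      change ((x ⬝ᵥ x)⁻¹ • x) ⬝ᵥ x = 1
      rw [smul_dotProduct, smul_eq_mul, inv_mul_cancel₀ hxx]
    have hCBv : C * (Bb * replicateCol Unit x) = 0 := by
      rw [← Matrix.mul_assoc]
      ext i j
      exact congrFun hx i
    exact ⟨_, _, _, _, _, _, (h.extend ha hA hX hwv hCBv).reindex
      ((finSumFinEquiv.symm).trans (Equiv.sumCongr (Equiv.refl _) (Equiv.ofUnique (Fin 1) Unit)))⟩

end LTI

open LTI in
theorem corollary1 {n m p : ℕ} (hmp : m ≤ p) (hpn : p ≤ n)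
    (Am : Matrix (Fin n) (Fin n) ℝ) (Bm : Matrix (Fin n) (Fin m) ℝ)
    (Cm : Matrix (Fin p) (Fin n) ℝ)
    (hmin : LTI.IsMinimal Am Bm Cm) (hstab : LTI.IsHurwitz Am)
    (hrank : (LTI.transferMatrix Am Bm Cm 0).rank = m)
    (hdef : (Cm * Bm).rank < m) :
    ∃ (nz : ℕ) (Az : Matrix (Fin nz) (Fin nz) ℝ) (Bz : Matrix (Fin nz) (Fin m) ℝ)
      (Cz : Matrix (Fin m) (Fin nz) ℝ) (Dz : Matrix (Fin m) (Fin m) ℝ)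
      (Bbar : Matrix (Fin n) (Fin m) ℝ) (Tz : Matrix (Fin n) (Fin nz) ℝ),
      -- `Z` is stable and invertible, and its system matrix is nonsingular everywhere
      LTI.IsHurwitz Az ∧
      (∀ s : ℂ, (LTI.systemMatrix Az Bz Cz Dz s).det ≠ 0) ∧
      IsUnit (LTI.transferMatrix Az Bz Cz Dz) ∧
      -- the factorization
      LTI.transferMatrix Am Bbar Cm 0 =
        LTI.transferMatrix Am Bm Cm 0 * (LTI.transferMatrix Az Bz Cz Dz)⁻¹ ∧
      -- the state-space identities
      Am * Tz = Tz * Az + Bbar * Cz ∧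
      Cm * Am * Tz = Cm * Bbar * Cz ∧
      Bm = Tz * Bz + Bbar * Dz ∧
      Cm * Bm = Cm * Bbar * Dz ∧
      Tz.rank = nz ∧
      LTI.IsControllable Am Bbar ∧
      (Cm * Bbar).rank = m ∧
      (LTI.NoUnstableZeros Am Bm Cm 0 → LTI.NoUnstableZeros Am Bbar Cm 0) := by
  obtain ⟨a, ha, hA⟩ := exists_pos_isUnit_add_smul_one Am
  have hspan := inputsSpan_of_isControllable hmin.1
  have hX := pencilInjective_X_iff.mpr
    ((rank_eq_card_iff _).mp (hrank.trans (Fintype.card_fin m).symm))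
  rw [Matrix.map_zero _ (map_zero _)] at hX
  obtain ⟨k, Az, Bz, Cz, Dz, Bb, T, h, hfull⟩ : ∃ (k : ℕ) (Az : Matrix (Fin k) (Fin k) ℝ)
      (Bz : Matrix (Fin k) (Fin m) ℝ) (Cz : Matrix (Fin m) (Fin k) ℝ)
      (Dz : Matrix (Fin m) (Fin m) ℝ) (Bb : Matrix (Fin n) (Fin m) ℝ)
      (T : Matrix (Fin n) (Fin k) ℝ),
      IsCascade a Am Bm Cm Az Bz Cz Dz Bb T ∧ (Cm * Bb).rank = m := by
    by_contra hne
    -- With `n + 1` states, `T` would be an injective `n × (n + 1)` matrix.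
    obtain ⟨Az, Bz, Cz, Dz, Bb, T, h⟩ := exists_isCascade_of_rank_lt ha hA hspan hX
      (fun k Az Bz Cz Dz Bb T h => lt_of_le_of_ne (Matrix.rank_le_width _)
        fun he => hne ⟨k, Az, Bz, Cz, Dz, Bb, T, h, he⟩) (n + 1)
    have h₁ := (rank_eq_card_iff T).mpr h.injective
    have h₂ := T.rank_le_height
    rw [Fintype.card_fin] at h₁
    omega
  have hZ : IsUnit (transferMatrix Az Bz Cz Dz) := by
    rw [Matrix.isUnit_iff_isUnit_det, isUnit_iff_ne_zero]
    intro h0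
    obtain ⟨x, hx, hx0⟩ := Matrix.exists_mulVec_eq_zero_iff.mpr h0
    exact hx (pencilInjective_X_iff.mp (h.pencil _ RatFunc.X) x hx0)
  refine ⟨k, Az, Bz, Cz, Dz, Bb, T, isHurwitz_of_forall_eigenvector h.stable, fun s h0 => ?_, hZ,
    ?_, h.state, ?_, h.input, ?_,
    ((rank_eq_card_iff T).mpr h.injective).trans (Fintype.card_fin k), h.span.isControllable,
    hfull, fun hnz s hs => ?_⟩
  · obtain ⟨x, hx, hx0⟩ := Matrix.exists_mulVec_eq_zero_iff.mpr h0
    exact hx ((pencilInjective_iff ..).mp (h.pencil ℂ s) x hx0)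
  · rw [← transferMatrix_mul_of_cascade h.state h.output h.input, Matrix.mul_assoc,
      Matrix.mul_nonsing_inv _ ((Matrix.isUnit_iff_isUnit_det _).mp hZ), Matrix.mul_one]
  · rw [Matrix.mul_assoc, h.state, Matrix.mul_add, ← Matrix.mul_assoc, h.output, Matrix.zero_mul,
      zero_add, Matrix.mul_assoc]
  · conv_lhs => rw [h.input]
    rw [Matrix.mul_add, ← Matrix.mul_assoc, h.output, Matrix.zero_mul, zero_add, Matrix.mul_assoc]
  · by_contra hre
    rw [not_lt] at hre
    -- The only zero that can be created, `-a`, is stable.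
    have hsa : s + algebraMap ℝ ℂ a ≠ 0 := fun h0 => by
      have := congrArg Complex.re h0
      simp at this
      linarith
    have h₁ := (not_isTransmissionZero_iff hmp Am Bm Cm 0 s).mp fun hz =>
      absurd (hnz s hz) (not_lt.mpr hre)
    rw [Matrix.map_zero _ (map_zero _)] at h₁
    have h₂ := h.zeros ℂ s hsa h₁
    refine (not_isTransmissionZero_iff hmp Am Bb Cm 0 s).mpr ?_ hs
    rwa [Matrix.map_zero _ (map_zero _)]
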